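/- Let $A=(a_{ij})$ be a $d\times d$ matrix of non-negative integers, invertible over $\mathbb Q$, and let $W(x_1,\dots,x_d)=\sum_{i=1}^d\prod_{j=1}^d x_j^{a_{ij}}$. Assume that the rational numbers $q_j$ determined by $\sum_j a_{ij}q_j=1$ for all $i$ are positive, that $W$ is non-degenerate, i.e. the hypersurface $W=0$ in $\mathbb C^d$ is smooth away from the origin (at every nonzero point of it some partial derivative of $W$ is nonzero), and that $\sum_j q_j$ is a positive integer. Let $\mathrm{Aut}(W)=\{\gamma\in(\mathbb C^*)^d:\prod_j\gamma_j^{a_{ij}}=1\text{ for all }i\}$, a finite group, let $SL_W=\{\gamma\in\mathrm{Aut}(W):\prod_j\gamma_j=1\}$ and $J_W=(e^{2\pi i q_j})_j$, and let $G$ be a group with $\langle J_W\rangle\subset G\subset SL_W$. For $n\in G$ let $\theta_j(n)\in[0,1)$ be the number with $n_j=e^{2\pi i\theta_j(n)}$. Let $H$ be the upper half-plane and, for $\nu\in\mathbb C$, $\tau\in H$, $q=e^{2\pi i\tau}$, let $$\Theta(\nu,\tau)=i\,q^{1/8}e^{-i\pi\nu}(1-e^{2\pi i\nu})\prod_{m=1}^\infty(1-q^m)(1-q^me^{2\pi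 i\nu})(1-q^me^{-2\pi i\nu}),\qquad q^{1/8}=e^{2\pi i\tau/8}.$$ Put $$Ell(W/G,z,\tau)=\frac1{|G|}\sum_{n,n_1\in G}\ \prod_{j=1}^d e^{-2\pi i z\theta_j(n)}\,\frac{\Theta\big((1-q_j)z-\theta_j(n)\tau-\theta_j(n_1),\tau\big)}{\Theta\big(q_jz+\theta_j(n)\tau+\theta_j(n_1),\tau\big)}$$ at every point $(z,\tau)\in\mathbb C\times H$ at which none of the denominators vanishes. Then these points are dense in $\mathbb C\times H$, and $Ell(W/G,z,\tau)$ extends from them to a (necessarily unique) holomorphic function of the two variables $(z,\tau)$ on all of $\mathbb C\times H$. -/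

import Mathlib

open Complex

noncomputable section

namespace BerglundHubsch

/-- The polynomial `W(x₁, …, x_d) = ∑ i, ∏ j, x_j ^ a_{ij}` with exponent matrix `A = (a_{ij})`. -/
def potential {d : ℕ} (A : Matrix (Fin d) (Fin d) ℕ) : MvPolynomial (Fin d) ℂ :=
  ∑ i, ∏ j, MvPolynomial.X j ^ A i j

/-- Non-degeneracy: the hypersurface `W = 0` in `ℂ^d` is smooth away from the origin, i.e. at every
nonzero point of it some partial derivative of `W` does not vanish. -/
def IsNondegenerate {d : ℕ} (W : MvPolynomial (Fin d) ℂ) : Prop :=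
  ∀ x : Fin d → ℂ, x ≠ 0 → MvPolynomial.eval x W = 0 →
    ∃ j, MvPolynomial.eval x (MvPolynomial.pderiv j W) ≠ 0

/-- The group `Aut(W)` of diagonal automorphisms `x_j ↦ γ_j x_j` preserving every monomial of
`W`. -/
def autGroup {d : ℕ} (A : Matrix (Fin d) (Fin d) ℕ) : Subgroup (Fin d → ℂˣ) where
  carrier := {γ | ∀ i, ∏ j, γ j ^ A i j = 1}
  one_mem' := by intro i; simp
  mul_mem' := by
    intro a b ha hb i
    simp only [Pi.mul_apply, mul_pow, Finset.prod_mul_distrib]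
    rw [ha i, hb i, one_mul]
  inv_mem' := by
    intro a ha i
    simp only [Pi.inv_apply, inv_pow, Finset.prod_inv_distrib]
    rw [ha i, inv_one]

/-- The group `SL_W` of the diagonal automorphisms of `W` with determinant one. -/
def slGroup {d : ℕ} (A : Matrix (Fin d) (Fin d) ℕ) : Subgroup (Fin d → ℂˣ) where
  carrier := {γ | γ ∈ autGroup A ∧ ∏ j, γ j = 1}
  one_mem' := ⟨one_mem _, by simp⟩
  mul_mem' := by
    intro a b ha hb
    refine ⟨mul_mem ha.1 hb.1, ?_⟩
    simp only [Pi.mul_apply, Finset.prod_mul_distrib]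
    rw [ha.2, hb.2, one_mul]
  inv_mem' := by
    intro a ha
    refine ⟨inv_mem ha.1, ?_⟩
    simp only [Pi.inv_apply, Finset.prod_inv_distrib]
    rw [ha.2, inv_one]

/-- The exponential grading operator `J_W : x_j ↦ exp(2 π i q_j) x_j`. -/
def gradingOp {d : ℕ} (q : Fin d → ℚ) : Fin d → ℂˣ :=
  fun j => Units.mk0 (exp (2 * Real.pi * I * (q j : ℂ))) (exp_ne_zero _)

/-- `θ_j(γ)`: the number in `[0, 1)` with `γ_j = exp(2 π i θ_j(γ))` (for `|γ_j| = 1`, which holds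
for all elements of `Aut(W)` when `A` is invertible). -/
def angle {d : ℕ} (γ : Fin d → ℂˣ) (j : Fin d) : ℝ :=
  Int.fract (arg (γ j : ℂ) / (2 * Real.pi))

/-- Jacobi's theta function
`Θ(ν, τ) = i q^{1/8} e^{-iπν} (1 - e^{2πiν}) ∏_{n ≥ 1} (1 - qⁿ)(1 - qⁿ e^{2πiν})(1 - qⁿ e^{-2πiν})`,
where `q = e^{2πiτ}`. -/
def jacobiTheta (ν τ : ℂ) : ℂ :=
  I * exp (2 * Real.pi * I * τ / 8) * exp (-(I * Real.pi * ν)) * (1 - exp (2 * Real.pi * I * ν)) *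
    ∏' n : ℕ,
      (1 - exp (2 * Real.pi * I * τ) ^ (n + 1)) *
      (1 - exp (2 * Real.pi * I * τ) ^ (n + 1) * exp (2 * Real.pi * I * ν)) *
      (1 - exp (2 * Real.pi * I * τ) ^ (n + 1) * exp (-(2 * Real.pi * I * ν)))

/-- The numerator `Θ((1 - q_j) z - θ_j(n) τ - θ_j(n₁), τ)`. -/
def numTheta {d : ℕ} (q : Fin d → ℚ) (n n₁ : Fin d → ℂˣ) (j : Fin d) (z τ : ℂ) : ℂ :=
  jacobiTheta ((1 - (q j : ℂ)) * z - (angle n j : ℂ) * τ - (angle n₁ j : ℂ)) τ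

/-- The denominator `Θ(q_j z + θ_j(n) τ + θ_j(n₁), τ)`. -/
def denTheta {d : ℕ} (q : Fin d → ℚ) (n n₁ : Fin d → ℂˣ) (j : Fin d) (z τ : ℂ) : ℂ :=
  jacobiTheta ((q j : ℂ) * z + (angle n j : ℂ) * τ + (angle n₁ j : ℂ)) τ

/-- The orbifold sum `Ell(W/G, z, τ)`, meaningful where no denominator vanishes. The sum over
`n, n₁ ∈ G` is finite for every subgroup `G` of `Aut(W)` by `finite_of_le_autGroup`. -/
def ell {d : ℕ} (q : Fin d → ℚ) (G : Subgroup (Fin d → ℂˣ)) (z τ : ℂ) : ℂ :=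
  1 / (Nat.card G : ℂ) *
    ∑ᶠ p : G × G, ∏ j, exp (-(I * 2 * Real.pi * z * (angle (p.1 : Fin d → ℂˣ) j : ℂ))) *
      (numTheta q p.1 p.2 j z τ / denTheta q p.1 p.2 j z τ)

/-- `ℂ × H`, where `H` is the upper half-plane. -/
def jacobiDomain : Set (ℂ × ℂ) := {p | 0 < p.2.im}

/-- The points of `ℂ × H` at which no denominator of the orbifold sum vanishes. -/
def regularSet {d : ℕ} (q : Fin d → ℚ) (G : Subgroup (Fin d → ℂˣ)) : Set (ℂ × ℂ) :=
  {p | p ∈ jacobiDomain ∧ ∀ n ∈ G, ∀ n₁ ∈ G, ∀ j, denTheta q n n₁ j p.1 p.2 ≠ 0}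

theorem finite_of_le_autGroup {d : ℕ} (A : Matrix (Fin d) (Fin d) ℕ)
    (hA : IsUnit (A.map (Nat.cast : ℕ → ℚ))) (G : Subgroup (Fin d → ℂˣ))
    (hG : G ≤ autGroup A) : Finite G := by
  set B : Matrix (Fin d) (Fin d) ℤ := A.map (Nat.cast : ℕ → ℤ) with hB
  have hdet : B.det ≠ 0 := by
    intro h0
    have h1 : (A.map (Nat.cast : ℕ → ℚ)).det = ((B.det : ℤ) : ℚ) := by
      rw [show A.map (Nat.cast : ℕ → ℚ) = (Int.castRingHom ℚ).mapMatrix B by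
        ext i j; simp [hB], ← RingHom.map_det]
      rfl
    have h2 := (Matrix.isUnit_iff_isUnit_det _).1 hA
    rw [h1, h0] at h2
    simp at h2
  have zsum : ∀ (g : ℂˣ) (s : Finset (Fin d)) (f : Fin d → ℤ),
      ∏ i ∈ s, g ^ f i = g ^ ∑ i ∈ s, f i := by
    intro g s f
    classical
    induction s using Finset.induction_on with
    | empty => simp
    | insert a s ha ih => rw [Finset.prod_insert ha, Finset.sum_insert ha, zpow_add, ih]
  have key : ∀ γ ∈ autGroup A, ∀ j, γ j ^ B.det.natAbs = 1 := by
    intro γ hγ j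
    have h1 : γ j ^ B.det = 1 := by
      have h2 : ∏ i, (∏ k, γ k ^ A i k) ^ (B.adjugate j i) = 1 :=
        Finset.prod_eq_one fun i _ => by rw [hγ i, one_zpow]
      have h3 : ∏ i, (∏ k, γ k ^ A i k) ^ (B.adjugate j i)
          = ∏ k, γ k ^ ((B.adjugate * B) j k) := by
        simp only [Matrix.mul_apply, ← Finset.prod_zpow]
        rw [Finset.prod_comm]
        refine Finset.prod_congr rfl fun k _ => ?_
        rw [← zsum]
        refine Finset.prod_congr rfl fun i _ => ?_
        rw [← zpow_natCast, ← zpow_mul, mul_comm]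
        simp [hB]
      rw [h3, Matrix.adjugate_mul] at h2
      rw [← h2, Finset.prod_eq_single j]
      · simp
      · intro k _ hk
        simp [Matrix.one_apply_ne hk.symm]
      · simp
    rcases Int.natAbs_eq B.det with h | h
    · rw [h] at h1; simpa using h1
    · rw [h] at h1; simpa using h1
  have : NeZero B.det.natAbs := ⟨by simpa using hdet⟩
  have hfin : Set.Finite {u : ℂˣ | u ^ B.det.natAbs = 1} :=
    (inferInstance : Finite (rootsOfUnity B.det.natAbs ℂ))
  have hpi : Set.Finite (Set.pi Set.univ fun _ : Fin d => {u : ℂˣ | u ^ B.det.natAbs = 1}) :=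
    Set.Finite.pi fun _ => hfin
  exact (hpi.subset fun γ hγ j _ => key γ (hG hγ) j).to_subtype

end BerglundHubsch

end

/-!
Every summand of the orbifold sum is holomorphic on `ℂ × H` by itself. Fix `n, n₁ ∈ G` and put
`D_j = q_j z + θ_j(n) τ + θ_j(n₁)`, so that the summand is, up to an exponential, the product of the
quotients `Θ(z - D_j, τ) / Θ(D_j, τ)`. Since `n` and `n₁` preserve each monomial of `W`,
`∑ j, a_{ij} D_j = z` holds on the elliptic curve `ℂ / (ℤτ + ℤ)` for all `i`.

As a function of its first variable, `Θ` has simple zeros, precisely at the lattice points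
(`jacobiTheta_eq_zero_iff`, `deriv_jacobiTheta_ne_zero`). For fixed `τ` there is therefore no pole
in `z` as soon as at every point the number of `j` with `D_j = 0` on the elliptic curve is at most
the number of `j` with `D_j = z`. That is `card_eq_zero_le_card_eq`, where the non-degeneracy of `W`
enters through the Nullstellensatz and Krull's height theorem. It requires all monomials of `W` to
have degree at least two; a monomial of degree one makes the whole sum zero (`ell_eq_zero`).

Filling in the removable singularities in `z` for each `τ` separately yields a function that is
holomorphic in both variables (`exists_differentiableOn_eq_div`): on small circles in the `z`-plane
around a given point no denominator vanishes for `τ` close to a given value, and inside such a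
circle Cauchy's integral formula expresses the function through its values on the circle.
-/

noncomputable section

open Set Filter Topology Metric

namespace BerglundHubsch

/-! ### Holomorphic functions of two variables -/

/-- A family of holomorphic functions depending continuously on a parameter has jointly continuous
derivatives, since derivatives of locally uniform limits converge. -/
theorem continuousOn_deriv_slice {X : Type*} [TopologicalSpace X] {f : X → ℂ → ℂ}
    {W : Set (X × ℂ)} (hW : IsOpen W) (hf : ContinuousOn (fun p : X × ℂ => f p.1 p.2) W)
    (hd : ∀ p ∈ W, DifferentiableAt ℂ (f p.1) p.2) :
    ContinuousOn (fun p : X × ℂ => deriv (f p.1) p.2) W := by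
  rintro ⟨x₀, z₀⟩ hp
  apply ContinuousAt.continuousWithinAt
  obtain ⟨N, U, hN, hU, hxN, hzU, hNU⟩ := isOpen_prod_iff.1 hW x₀ z₀ hp
  have hloc : TendstoLocallyUniformlyOn f (f x₀) (𝓝 x₀) U := by
    rw [Metric.tendstoLocallyUniformlyOn_iff]
    intro ε hε z hz
    have h1 : ContinuousAt (fun p : X × ℂ => f p.1 p.2) (x₀, z) :=
      hf.continuousAt (hW.mem_nhds (hNU ⟨hxN, hz⟩))
    have h2 : ∀ᶠ p : X × ℂ in 𝓝 (x₀, z), dist (f p.1 p.2) (f x₀ z) < ε / 2 :=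
      Metric.tendsto_nhds.1 h1 _ (half_pos hε)
    rw [nhds_prod_eq] at h2
    obtain ⟨s, hs, t, ht, hst⟩ := mem_prod_iff.1 h2
    refine ⟨t, mem_nhdsWithin_of_mem_nhds ht, ?_⟩
    filter_upwards [hs] with x hx y hy
    have a1 := hst (mk_mem_prod hx hy)
    have a2 := hst (mk_mem_prod (mem_of_mem_nhds hs) hy)
    simp only [mem_ofPred_eq] at a1 a2
    calc dist (f x₀ y) (f x y) ≤ dist (f x₀ y) (f x₀ z) + dist (f x y) (f x₀ z) :=
          dist_triangle_right _ _ _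
      _ < ε := by linarith
  have hdiff : ∀ᶠ x in 𝓝 x₀, DifferentiableOn ℂ (f x) U := by
    filter_upwards [hN.mem_nhds hxN] with x hx z hz
    exact (hd (x, z) (hNU ⟨hx, hz⟩)).differentiableWithinAt
  have hder := hloc.deriv hdiff hU
  have hcont : ContinuousAt (deriv (f x₀)) z₀ := by
    have : DifferentiableOn ℂ (f x₀) U := hdiff.self_of_nhds
    exact ((this.deriv hU).differentiableAt (hU.mem_nhds hzU)).continuousAt
  rw [ContinuousAt, Metric.tendsto_nhds]
  intro ε hε
  obtain ⟨t, ht, h3⟩ := Metric.tendstoLocallyUniformlyOn_iff.1 hder (ε / 2) (half_pos hε) z₀ hzU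
  rw [hU.nhdsWithin_eq hzU] at ht
  have h4 := Metric.tendsto_nhds.1 hcont (ε / 2) (half_pos hε)
  rw [nhds_prod_eq]
  filter_upwards [prod_mem_prod h3 (inter_mem ht h4)] with p hp
  have b1 := hp.1 p.2 hp.2.1
  have b2 := hp.2.2
  simp only [Function.comp_apply, mem_ofPred_eq] at b1 b2
  calc dist (deriv (f p.1) p.2) (deriv (f x₀) z₀)
      ≤ dist (deriv (f x₀) p.2) (deriv (f p.1) p.2)
        + dist (deriv (f x₀) p.2) (deriv (f x₀) z₀) := dist_triangle_left _ _ _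
    _ < ε := by linarith

/-- **Osgood's lemma** in two variables: a continuous, separately holomorphic function is
holomorphic. -/
theorem differentiableOn_of_separately {f : ℂ × ℂ → ℂ} {W : Set (ℂ × ℂ)} (hW : IsOpen W)
    (hf : ContinuousOn f W)
    (h₁ : ∀ p ∈ W, DifferentiableAt ℂ (fun z => f (z, p.2)) p.1)
    (h₂ : ∀ p ∈ W, DifferentiableAt ℂ (fun t => f (p.1, t)) p.2) :
    DifferentiableOn ℂ f W := by
  have c₂ : ContinuousOn (fun p : ℂ × ℂ => deriv (fun t => f (p.1, t)) p.2) W :=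
    continuousOn_deriv_slice (f := fun z t => f (z, t)) hW hf h₂
  have c₁ : ContinuousOn (fun p : ℂ × ℂ => deriv (fun z => f (z, p.2)) p.1) W := by
    have := continuousOn_deriv_slice (f := fun t z => f (z, t)) (W := Prod.swap ⁻¹' W)
      (hW.preimage continuous_swap) (hf.comp continuous_swap.continuousOn fun p hp => hp)
      (fun p hp => h₁ _ hp)
    exact this.comp (t := Prod.swap ⁻¹' W) continuous_swap.continuousOn fun p hp => by
      simpa using hp
  intro p hp
  have hWp := hW.mem_nhds hp
  let L : ℂ → (ℂ →L[ℂ] ℂ) := fun c => ContinuousLinearMap.toSpanSingleton ℂ c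
  have hL : Continuous L := (ContinuousLinearMap.toSpanSingletonCLE (𝕜 := ℂ) (E := ℂ)).continuous
  have := hasStrictFDerivAt_uncurry_coprod (𝕜 := ℂ) (u := p) (f := fun z t => f (z, t))
    (f₁ := fun z t => L (deriv (fun z => f (z, t)) z))
    (f₂ := fun z t => L (deriv (fun t => f (z, t)) t))
    (by filter_upwards [hWp] with v hv using (h₁ v hv).hasDerivAt.hasFDerivAt)
    (by filter_upwards [hWp] with v hv using (h₂ v hv).hasDerivAt.hasFDerivAt)
    (hL.continuousAt.comp (c₁.continuousAt hWp)) (hL.continuousAt.comp (c₂.continuousAt hWp))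
  exact this.hasFDerivAt.differentiableAt.differentiableWithinAt

theorem differentiableOn_of_tendstoLocallyUniformlyOn {ι : Type*} {l : Filter ι} [l.NeBot]
    {F : ι → ℂ × ℂ → ℂ} {f : ℂ × ℂ → ℂ} {W : Set (ℂ × ℂ)} (hW : IsOpen W)
    (h : TendstoLocallyUniformlyOn F f l W) (hF : ∀ i, DifferentiableOn ℂ (F i) W) :
    DifferentiableOn ℂ f W := by
  refine differentiableOn_of_separately hW
    (h.continuousOn (Eventually.of_forall fun i => (hF i).continuousOn).frequently) ?_ ?_
  · intro p hp
    have ho : IsOpen ((fun z : ℂ => (z, p.2)) ⁻¹' W) := hW.preimage (by fun_prop)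
    have := h.comp (fun z : ℂ => (z, p.2)) (mapsTo_preimage _ W) (by fun_prop)
    refine (this.differentiableOn (Eventually.of_forall fun i => ?_) ho).differentiableAt
      (ho.mem_nhds hp)
    exact (hF i).comp (by fun_prop) (mapsTo_preimage _ W)
  · intro p hp
    have ho : IsOpen ((fun t : ℂ => (p.1, t)) ⁻¹' W) := hW.preimage (by fun_prop)
    have := h.comp (fun t : ℂ => (p.1, t)) (mapsTo_preimage _ W) (by fun_prop)
    refine (this.differentiableOn (Eventually.of_forall fun i => ?_) ho).differentiableAt
      (ho.mem_nhds hp)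
    exact (hF i).comp (by fun_prop) (mapsTo_preimage _ W)

theorem differentiableAt_intervalIntegral {k : ℝ → ℂ → ℂ} {V : Set ℂ} (hV : IsOpen V) {a b : ℝ}
    (hk : ContinuousOn (fun p : ℝ × ℂ => k p.1 p.2) (univ ×ˢ V))
    (hd : ∀ x, DifferentiableOn ℂ (k x) V) {t₀ : ℂ} (ht₀ : t₀ ∈ V) :
    DifferentiableAt ℂ (fun t => ∫ x in a..b, k x t) t₀ := by
  have hc := continuousOn_deriv_slice (isOpen_univ.prod hV) hk
    (fun p hp => (hd p.1).differentiableAt (hV.mem_nhds hp.2))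
  obtain ⟨ε, hε, hball⟩ := nhds_basis_closedBall.mem_iff.1 (hV.mem_nhds ht₀)
  have hcomp : IsCompact (uIcc a b ×ˢ closedBall t₀ ε) := isCompact_uIcc.prod
    (isCompact_closedBall _ _)
  obtain ⟨C, hC⟩ := hcomp.exists_bound_of_continuousOn
    (hc.mono (prod_mono (subset_univ _) hball))
  have hslice : ∀ t ∈ V, Continuous fun x => k x t := fun t ht =>
    hk.comp_continuous (f := fun x : ℝ => (x, t)) (by fun_prop) fun x => ⟨trivial, ht⟩
  have hslice' : Continuous fun x => deriv (k x) t₀ :=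
    hc.comp_continuous (f := fun x : ℝ => (x, t₀)) (by fun_prop) fun x => ⟨trivial, ht₀⟩
  have := intervalIntegral.hasDerivAt_integral_of_dominated_loc_of_deriv_le
    (μ := MeasureTheory.volume) (a := a) (b := b)
    (F := fun t x => k x t) (F' := fun t x => deriv (k x) t) (x₀ := t₀) (bound := fun _ => C)
    (closedBall_mem_nhds t₀ hε)
    (by filter_upwards [hV.mem_nhds ht₀] with t ht using (hslice t ht).aestronglyMeasurable)
    ((hslice t₀ ht₀).intervalIntegrable _ _) hslice'.aestronglyMeasurable
    (Eventually.of_forall fun x hx t ht => hC (x, t) ⟨uIoc_subset_uIcc hx, ht⟩)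
    (by simp)
    (Eventually.of_forall fun x _ t ht =>
      ((hd x).differentiableAt (hV.mem_nhds (hball ht))).hasDerivAt)
  exact this.2.differentiableAt

theorem differentiable_toMeromorphicNFOn_div {P Q : ℂ → ℂ} (hP : Differentiable ℂ P)
    (hQ : Differentiable ℂ Q) (hord : ∀ z, analyticOrderAt Q z ≤ analyticOrderAt P z)
    (hfin : ∀ z, analyticOrderAt Q z ≠ ⊤) :
    Differentiable ℂ (toMeromorphicNFOn (fun z => P z / Q z) univ) := by
  have hm : MeromorphicOn (fun z => P z / Q z) univ := fun z _ =>
    (hP.analyticAt z).meromorphicAt.div (hQ.analyticAt z).meromorphicAt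
  intro z
  have hNF := meromorphicNFOn_toMeromorphicNFOn (fun z => P z / Q z) univ (mem_univ z)
  refine (hNF.meromorphicOrderAt_nonneg_iff_analyticAt.1 ?_).differentiableAt
  rw [meromorphicOrderAt_toMeromorphicNFOn hm (mem_univ z)]
  have h1 : meromorphicOrderAt (fun z => P z / Q z) z
      = meromorphicOrderAt P z - meromorphicOrderAt Q z :=
    meromorphicOrderAt_div (hP.analyticAt z).meromorphicAt (hQ.analyticAt z).meromorphicAt
  rw [h1, (hP.analyticAt z).meromorphicOrderAt_eq, (hQ.analyticAt z).meromorphicOrderAt_eq]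
  have h2 := hord z
  lift analyticOrderAt Q z to ℕ using hfin z with b hb
  cases hc : analyticOrderAt P z with
  | top => simp
  | coe a =>
    rw [hc] at h2
    have h3 : b ≤ a := by exact_mod_cast h2
    simp only [ENat.map_natCast]
    change ((0 : ℤ) : WithTop ℤ) ≤ ((a : ℤ) : WithTop ℤ) - ((b : ℤ) : WithTop ℤ)
    rw [← WithTop.LinearOrderedAddCommGroup.coe_sub, WithTop.coe_le_coe]
    exact_mod_cast sub_nonneg.2 (Nat.cast_le (α := ℤ).2 h3)

theorem toMeromorphicNFOn_div_eq {P Q : ℂ → ℂ} (hP : Differentiable ℂ P)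
    (hQ : Differentiable ℂ Q) {z : ℂ} (hz : Q z ≠ 0) :
    toMeromorphicNFOn (fun z => P z / Q z) univ z = P z / Q z := by
  have hm : MeromorphicOn (fun z => P z / Q z) univ := fun z _ =>
    (hP.analyticAt z).meromorphicAt.div (hQ.analyticAt z).meromorphicAt
  have hNF : MeromorphicNFAt (fun z => P z / Q z) z :=
    ((hP.analyticAt z).fun_div (hQ.analyticAt z) hz).meromorphicNFAt
  rw [toMeromorphicNFOn_eq_toMeromorphicNFAt hm (mem_univ z), toMeromorphicNFAt_eq_self.2 hNF]

/-- A function on `ball z₀ r × V` that is entire in the first variable, and is holomorphic in two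
variables near the boundary `sphere z₀ r × V`, is holomorphic in two variables: it is continuous by
the maximum principle, and holomorphic in the second variable by Cauchy's integral formula. -/
theorem differentiableOn_of_eqOn_sphere {F f : ℂ × ℂ → ℂ} {V : Set ℂ} (hV : IsOpen V) {z₀ : ℂ}
    {r : ℝ} (hr : 0 < r) {N : Set (ℂ × ℂ)} (hN : IsOpen N) (hNV : sphere z₀ r ×ˢ V ⊆ N)
    (hf : DifferentiableOn ℂ f N)
    (hF : ∀ t ∈ V, Differentiable ℂ fun z => F (z, t))
    (hFf : ∀ t ∈ V, ∀ z ∈ sphere z₀ r, F (z, t) = f (z, t)) :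
    DifferentiableOn ℂ F (ball z₀ r ×ˢ V) := by
  have hmem : ∀ θ, circleMap z₀ r θ ∈ sphere z₀ r := circleMap_mem_sphere z₀ hr.le
  refine differentiableOn_of_separately (isOpen_ball.prod hV) ?_ (fun p hp => hF _ hp.2 _) ?_
  · rintro ⟨z₁, t₁⟩ ⟨hz₁, ht₁⟩
    apply ContinuousAt.continuousWithinAt
    rw [ContinuousAt, Metric.tendsto_nhds]
    intro ε hε
    have key : ∀ᶠ t in 𝓝 t₁, ∀ ζ ∈ sphere z₀ r, dist (f (ζ, t)) (f (ζ, t₁)) < ε / 3 := by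
      refine (isCompact_sphere z₀ r).eventually_forall_of_forall_eventually fun ζ hζ => ?_
      have hc : ContinuousAt f (ζ, t₁) :=
        hf.continuousOn.continuousAt (hN.mem_nhds (hNV ⟨hζ, ht₁⟩))
      have e1 : Tendsto (fun p : ℂ × ℂ => f (p.2, p.1)) (𝓝 (t₁, ζ)) (𝓝 (f (ζ, t₁))) :=
        hc.tendsto.comp
          (Continuous.tendsto (f := fun p : ℂ × ℂ => (p.2, p.1)) (by fun_prop) (t₁, ζ))
      have e2 : Tendsto (fun p : ℂ × ℂ => f (p.2, t₁)) (𝓝 (t₁, ζ)) (𝓝 (f (ζ, t₁))) :=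
        hc.tendsto.comp (Continuous.tendsto (f := fun p : ℂ × ℂ => (p.2, t₁)) (by fun_prop) (t₁, ζ))
      have := e1.dist e2
      rw [dist_self] at this
      exact this.eventually (gt_mem_nhds (by positivity))
    have hcz := Metric.tendsto_nhds.1 ((hF t₁ ht₁).continuous.tendsto z₁) (ε / 3) (by positivity)
    rw [nhds_prod_eq]
    filter_upwards [prod_mem_prod (inter_mem (isOpen_ball.mem_nhds hz₁) hcz)
      (inter_mem (hV.mem_nhds ht₁) key)] with p hp
    have hm := norm_le_of_forall_mem_frontier_norm_le (U := ball z₀ r) isBounded_ball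
      (f := fun z => F (z, p.2) - F (z, t₁)) (C := ε / 3)
      ((hF _ hp.2.1).sub (hF _ ht₁)).diffContOnCl
      (fun z hz => by
        rw [frontier_ball _ hr.ne'] at hz
        rw [hFf _ hp.2.1 z hz, hFf _ ht₁ z hz, ← dist_eq_norm]
        exact (hp.2.2 z hz).le) (subset_closure hp.1.1)
    rw [← dist_eq_norm] at hm
    have h2 : dist (F (p.1, t₁)) (F (z₁, t₁)) < ε / 3 := hp.1.2
    calc dist (F p) (F (z₁, t₁))
        ≤ dist (F (p.1, p.2)) (F (p.1, t₁)) + dist (F (p.1, t₁)) (F (z₁, t₁)) :=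
          dist_triangle _ _ _
      _ < ε := by linarith
  · rintro ⟨z₁, t₁⟩ ⟨hz₁, ht₁⟩
    have hne : ∀ θ, circleMap z₀ r θ - z₁ ≠ 0 := fun θ h => by
      have h1 := hmem θ
      rw [sub_eq_zero.1 h, mem_sphere] at h1
      rw [mem_ball] at hz₁
      exact absurd h1 hz₁.ne
    have hk : ContinuousOn (fun p : ℝ × ℂ => deriv (circleMap z₀ r) p.1 •
        ((circleMap z₀ r p.1 - z₁)⁻¹ • f (circleMap z₀ r p.1, p.2))) (univ ×ˢ V) := by
      refine ContinuousOn.fun_smul ?_ (ContinuousOn.fun_smul ?_ ?_)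
      · simp only [deriv_circleMap]; fun_prop
      · exact ContinuousOn.inv₀ (by fun_prop) fun p _ => hne p.1
      · exact hf.continuousOn.comp (by fun_prop) fun p hp => hNV ⟨hmem _, hp.2⟩
    have := differentiableAt_intervalIntegral (a := 0) (b := 2 * Real.pi) hV
      (k := fun θ t => deriv (circleMap z₀ r) θ •
        ((circleMap z₀ r θ - z₁)⁻¹ • f (circleMap z₀ r θ, t))) hk
      (fun θ => by
        refine DifferentiableOn.fun_const_smul (DifferentiableOn.fun_const_smul ?_ _) _
        exact hf.comp (by fun_prop) fun t ht => hNV ⟨hmem _, ht⟩) ht₁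
    refine (this.const_smul ((2 * Real.pi * I : ℂ)⁻¹)).congr_of_eventuallyEq ?_
    filter_upwards [hV.mem_nhds ht₁] with t ht
    have hC := (hF t ht).diffContOnCl.two_pi_i_inv_smul_circleIntegral_sub_inv_smul
      (c := z₀) (R := r) hz₁
    simp only at hC ⊢
    rw [← hC]
    congr 1
    rw [circleIntegral]
    refine intervalIntegral.integral_congr fun θ _ => ?_
    simp only [hFf t ht _ (hmem θ)]

/-- Whether a quotient of holomorphic functions on `ℂ × V` extends holomorphically can be tested on
each complex line `ℂ × {t}`, with no condition relating different `t`. -/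
theorem exists_differentiableOn_eq_div {V : Set ℂ} (hV : IsOpen V) {P Q : ℂ × ℂ → ℂ}
    (hP : DifferentiableOn ℂ P (univ ×ˢ V)) (hQ : DifferentiableOn ℂ Q (univ ×ˢ V))
    (hord : ∀ t ∈ V, ∀ z,
      analyticOrderAt (fun z => Q (z, t)) z ≤ analyticOrderAt (fun z => P (z, t)) z)
    (hfin : ∀ t ∈ V, ∀ z, analyticOrderAt (fun z => Q (z, t)) z ≠ ⊤) :
    ∃ F : ℂ × ℂ → ℂ, DifferentiableOn ℂ F (univ ×ˢ V) ∧
      ∀ p ∈ univ ×ˢ V, Q p ≠ 0 → F p = P p / Q p := by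
  have hslice : ∀ {R : ℂ × ℂ → ℂ}, DifferentiableOn ℂ R (univ ×ˢ V) → ∀ t ∈ V,
      Differentiable ℂ fun z => R (z, t) := fun {R} hR t ht => by
    rw [← differentiableOn_univ]
    exact hR.comp (by fun_prop) fun z _ => ⟨trivial, ht⟩
  have ho : IsOpen ((univ : Set ℂ) ×ˢ V) := isOpen_univ.prod hV
  -- on each line `ℂ × {t}` the removable singularities are filled in
  let F : ℂ × ℂ → ℂ := fun p => toMeromorphicNFOn (fun z => P (z, p.2) / Q (z, p.2)) univ p.1
  have hFeq : ∀ p ∈ univ ×ˢ V, Q p ≠ 0 → F p = P p / Q p := fun p hp hQp =>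
    toMeromorphicNFOn_div_eq (hslice hP _ hp.2) (hslice hQ _ hp.2) hQp
  refine ⟨F, ?_, hFeq⟩
  rintro ⟨z₀, t₀⟩ ⟨-, ht₀⟩
  have hQ₀ :=
    ((hslice hQ t₀ ht₀).analyticAt z₀).eventually_eq_zero_or_eventually_ne_zero.resolve_left
      fun h => hfin t₀ ht₀ z₀ (analyticOrderAt_eq_top.2 h)
  obtain ⟨ε, hε, hball⟩ := Metric.mem_nhdsWithin_iff.1 hQ₀
  -- `Q` has no zero on a small circle around `z₀` for `t = t₀`, hence none for `t` near `t₀`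
  have hsph : ∀ ζ ∈ sphere z₀ (ε / 2), Q (ζ, t₀) ≠ 0 := fun ζ hζ => by
    rw [mem_sphere] at hζ
    refine hball ⟨?_, fun h => ?_⟩
    · rw [mem_ball, hζ]; linarith
    · rw [mem_singleton_iff.1 h, dist_self] at hζ; linarith
  let N : Set (ℂ × ℂ) := (univ ×ˢ V) ∩ Q ⁻¹' {0}ᶜ
  have hN : IsOpen N := hQ.continuousOn.isOpen_inter_preimage ho isOpen_compl_singleton
  have key : ∀ᶠ t in 𝓝 t₀, ∀ ζ ∈ sphere z₀ (ε / 2), (ζ, t) ∈ N := by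
    refine (isCompact_sphere z₀ _).eventually_forall_of_forall_eventually fun ζ hζ => ?_
    have hc : Tendsto (fun p : ℂ × ℂ => (p.2, p.1)) (𝓝 (t₀, ζ)) (𝓝 (ζ, t₀)) :=
      Continuous.tendsto (f := fun p : ℂ × ℂ => (p.2, p.1)) (by fun_prop) (t₀, ζ)
    exact hc.eventually (hN.mem_nhds ⟨⟨trivial, ht₀⟩, hsph ζ hζ⟩)
  obtain ⟨V', hV'key, hV', ht₀'⟩ := _root_.eventually_nhds_iff.1 key
  have hf : DifferentiableOn ℂ (fun p => P p / Q p) N := by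
    have hP' : DifferentiableOn ℂ P N := hP.mono inter_subset_left
    have hQ' : DifferentiableOn ℂ Q N := hQ.mono inter_subset_left
    simp only [div_eq_mul_inv]
    exact hP'.fun_mul (hQ'.fun_inv fun p hp => hp.2)
  have hε' : 0 < ε / 2 := half_pos hε
  have hNV : sphere z₀ (ε / 2) ×ˢ (V ∩ V') ⊆ N := fun p hp => hV'key _ hp.2.2 _ hp.1
  have hent : ∀ t ∈ V ∩ V', Differentiable ℂ fun z => F (z, t) := fun t ht => by
    have := differentiable_toMeromorphicNFOn_div (hslice hP t ht.1) (hslice hQ t ht.1)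
      (hord t ht.1) (hfin t ht.1)
    exact this
  have hbd : ∀ t ∈ V ∩ V', ∀ z ∈ sphere z₀ (ε / 2), F (z, t) = P (z, t) / Q (z, t) :=
    fun t ht z hz => hFeq (z, t) ⟨trivial, ht.1⟩ (hV'key t ht.2 z hz).2
  clear_value F N
  have := differentiableOn_of_eqOn_sphere (hV.inter hV') hε' hN hNV hf hent hbd
  exact (this.differentiableAt ((isOpen_ball.prod (hV.inter hV')).mem_nhds
    ⟨mem_ball_self hε', ht₀, ht₀'⟩)).differentiableWithinAt

/-! ### The theta function and its zeros -/

/-- The infinite `q`-Pochhammer symbol `(w; q)_∞ = ∏_{n ≥ 0} (1 - qⁿ w)`, used for `‖q‖ < 1`. -/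
def qProd (w q : ℂ) : ℂ := ∏' n : ℕ, (1 - q ^ n * w)

theorem differentiableOn_finsetProd {E ι : Type*} [NormedAddCommGroup E] [NormedSpace ℂ E]
    {W : Set E} {f : ι → E → ℂ} (s : Finset ι) (hf : ∀ i, DifferentiableOn ℂ (f i) W) :
    DifferentiableOn ℂ (fun p => ∏ i ∈ s, f i p) W := by
  classical
  induction s using Finset.induction_on with
  | empty => simp only [Finset.prod_empty]; fun_prop
  | insert a s ha ih =>
    simp only [Finset.prod_insert ha]
    exact (hf a).fun_mul ih

theorem summable_norm_qProd (w : ℂ) {q : ℂ} (hq : ‖q‖ < 1) :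
    Summable fun n : ℕ => ‖-(q ^ n * w)‖ := by
  simp only [norm_neg, norm_mul, norm_pow]
  exact (summable_geometric_of_lt_one (norm_nonneg _) hq).mul_right _

theorem multipliable_qProd (w : ℂ) {q : ℂ} (hq : ‖q‖ < 1) :
    Multipliable fun n : ℕ => 1 - q ^ n * w := by
  simpa only [sub_eq_add_neg] using multipliable_one_add_of_summable (summable_norm_qProd w hq)

theorem differentiableOn_qProd :
    DifferentiableOn ℂ (fun p : ℂ × ℂ => qProd p.1 p.2) {p | ‖p.2‖ < 1} := by
  rintro p₀ hp₀
  obtain ⟨ρ, h1, h2⟩ := exists_between (show ‖p₀.2‖ < 1 from hp₀)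
  set K : Set (ℂ × ℂ) := {p | ‖p.1‖ < ‖p₀.1‖ + 1 ∧ ‖p.2‖ < ρ} with hKdef
  have hK : IsOpen K := by
    have h3 : IsOpen {p : ℂ × ℂ | ‖p.1‖ < ‖p₀.1‖ + 1} := isOpen_lt (by fun_prop) (by fun_prop)
    have h4 : IsOpen {p : ℂ × ℂ | ‖p.2‖ < ρ} := isOpen_lt (by fun_prop) (by fun_prop)
    exact h3.inter h4
  have hρ : 0 ≤ ρ := (norm_nonneg _).trans h1.le
  have hprod := Summable.hasProdLocallyUniformlyOn_nat_one_add (K := K)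
    (f := fun (n : ℕ) (p : ℂ × ℂ) => -(p.2 ^ n * p.1)) (u := fun n => ρ ^ n * (‖p₀.1‖ + 1)) hK
    ((summable_geometric_of_lt_one hρ h2).mul_right _)
    (Eventually.of_forall fun n p hp => by
      rw [norm_neg, norm_mul, norm_pow]
      have := hp.1.le
      have := hp.2.le
      gcongr) (fun n => by fun_prop)
  rw [hasProdLocallyUniformlyOn_iff_tendstoLocallyUniformlyOn] at hprod
  have hd := differentiableOn_of_tendstoLocallyUniformlyOn hK hprod fun s =>
    differentiableOn_finsetProd s fun i => by fun_prop
  have hmem : p₀ ∈ K := ⟨by simp, h1⟩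
  simp only [qProd, sub_eq_add_neg]
  exact (hd.differentiableAt (hK.mem_nhds hmem)).differentiableWithinAt

theorem qProd_eq_mul (w : ℂ) {q : ℂ} (hq : ‖q‖ < 1) :
    qProd w q = (1 - w) * qProd (q * w) q := by
  have h : Multipliable fun n : ℕ => 1 - q ^ (n + 1) * w := by
    simpa only [pow_succ, mul_assoc] using multipliable_qProd (q * w) hq
  have h2 := tprod_eq_zero_mul' (f := fun n : ℕ => 1 - q ^ n * w) h
  simp only [pow_zero, one_mul, pow_succ, mul_assoc] at h2
  exact h2

theorem qProd_eq_zero_iff (w : ℂ) {q : ℂ} (hq : ‖q‖ < 1) :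
    qProd w q = 0 ↔ ∃ n : ℕ, q ^ n * w = 1 := by
  constructor
  · intro h
    by_contra! hne
    refine tprod_one_add_ne_zero_of_summable (f := fun n : ℕ => -(q ^ n * w)) (fun n h0 => ?_)
      (summable_norm_qProd w hq) (by simpa only [qProd, sub_eq_add_neg] using h)
    exact hne n (by linear_combination -h0)
  · rintro ⟨n, hn⟩
    induction n generalizing w with
    | zero => rw [qProd_eq_mul w hq, show w = 1 by simpa using hn]; simp
    | succ n ih => rw [qProd_eq_mul w hq, ih (q * w) (by rw [← hn]; ring), mul_zero]

theorem differentiable_qProd_left {q : ℂ} (hq : ‖q‖ < 1) : Differentiable ℂ fun w => qProd w q := by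
  rw [← differentiableOn_univ]
  exact differentiableOn_qProd.comp (f := fun w : ℂ => (w, q)) (by fun_prop) fun w _ => hq

/-- The zeros `w = q⁻ⁿ` of the `q`-Pochhammer symbol are simple, by induction on `n` through
`qProd_eq_mul`. -/
theorem deriv_qProd_ne_zero {w q : ℂ} (hq : ‖q‖ < 1) (h : qProd w q = 0) :
    deriv (fun w => qProd w q) w ≠ 0 := by
  have hd := differentiable_qProd_left hq
  have hlt : ∀ n : ℕ, q ^ (n + 1) ≠ 1 := fun n h1 => by
    have := pow_lt_one₀ (norm_nonneg q) hq (Nat.succ_ne_zero n)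
    rw [← norm_pow, h1, norm_one] at this
    exact lt_irrefl _ this
  have hder : ∀ w, deriv (fun w => qProd w q) w
      = -qProd (q * w) q + (1 - w) * (deriv (fun w => qProd w q) (q * w) * q) := fun w => by
    have h1 : HasDerivAt (fun w => qProd (q * w) q) (deriv (fun w => qProd w q) (q * w) * q) w :=
      HasDerivAt.comp w (h₂ := fun w => qProd w q) (hd (q * w)).hasDerivAt
        (by simpa using (hasDerivAt_id w).const_mul q)
    have h2 := ((hasDerivAt_id w).const_sub 1).mul h1
    have h3 : (fun w => qProd w q) = (fun w => (1 - id w)) * fun w => qProd (q * w) q := by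
      funext w; exact qProd_eq_mul w hq
    have h4 := h2.deriv
    rw [← h3] at h4
    rw [h4]
    simp
  obtain ⟨n, hn⟩ := (qProd_eq_zero_iff w hq).1 h
  induction n generalizing w with
  | zero =>
    obtain rfl : w = 1 := by simpa using hn
    rw [hder]
    simp only [mul_one, sub_self, zero_mul, add_zero, neg_ne_zero, ne_eq, qProd_eq_zero_iff _ hq]
    rintro ⟨n, hn⟩
    exact hlt n (by rw [← hn, pow_succ])
  | succ n ih =>
    have hn' : q ^ n * (q * w) = 1 := by rw [← hn]; ring
    have h0 : qProd (q * w) q = 0 := (qProd_eq_zero_iff _ hq).2 ⟨n, hn'⟩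
    rw [hder, h0, neg_zero, zero_add]
    refine mul_ne_zero ?_ (mul_ne_zero (ih h0 hn') ?_)
    · intro hw
      rw [← sub_eq_zero.1 hw, mul_one] at hn
      exact hlt n hn
    · rintro rfl
      simp at hn'

theorem norm_nome_lt_one {τ : ℂ} (hτ : 0 < τ.im) : ‖exp (2 * Real.pi * I * τ)‖ < 1 := by
  rw [norm_exp, Real.exp_lt_one_iff]
  have : (2 * Real.pi * I * τ).re = -(2 * Real.pi * τ.im) := by simp
  rw [this]
  have := Real.pi_pos
  exact neg_neg_of_pos (by positivity)

/-- The theta function as a product of `q`-Pochhammer symbols; the factor `1 - e^{2πiν}` completes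
`∏_{n ≥ 1} (1 - qⁿ e^{2πiν})`. -/
theorem jacobiTheta_eq (ν : ℂ) {τ : ℂ} (hτ : 0 < τ.im) :
    jacobiTheta ν τ = I * exp (2 * Real.pi * I * τ / 8) * exp (-(I * Real.pi * ν)) *
      qProd (exp (2 * Real.pi * I * τ)) (exp (2 * Real.pi * I * τ)) *
      qProd (exp (2 * Real.pi * I * ν)) (exp (2 * Real.pi * I * τ)) *
      qProd (exp (2 * Real.pi * I * τ) * exp (-(2 * Real.pi * I * ν)))
        (exp (2 * Real.pi * I * τ)) := by
  have hq := norm_nome_lt_one hτ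
  rw [jacobiTheta]
  set q := exp (2 * Real.pi * I * τ)
  have h : ∀ w, ∏' n : ℕ, (1 - q ^ (n + 1) * w) = qProd (q * w) q := fun w => by
    simp only [qProd, pow_succ, mul_assoc]
  have hm : ∀ w, Multipliable fun n : ℕ => 1 - q ^ (n + 1) * w := fun w => by
    simpa only [pow_succ, mul_assoc] using multipliable_qProd (q * w) hq
  have h1 : ∏' n : ℕ, (1 - q ^ (n + 1)) = qProd q q := by simpa using h 1
  have hm1 : Multipliable fun n : ℕ => 1 - q ^ (n + 1) := by simpa using hm 1
  rw [(hm1.mul (hm _)).tprod_mul (hm _), hm1.tprod_mul (hm _), h1, h, h,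
    qProd_eq_mul (exp (2 * Real.pi * I * ν)) hq]
  ring

theorem isOpen_upperHalfPlane : IsOpen {τ : ℂ | 0 < τ.im} := isOpen_lt (by fun_prop) (by fun_prop)

theorem differentiableOn_jacobiTheta :
    DifferentiableOn ℂ (fun p : ℂ × ℂ => jacobiTheta p.1 p.2) jacobiDomain := by
  have hE : ∀ g : ℂ × ℂ → ℂ, Differentiable ℂ g →
      DifferentiableOn ℂ (fun p => qProd (g p) (exp (2 * Real.pi * I * p.2))) jacobiDomain :=
    fun g hg => differentiableOn_qProd.comp
      (f := fun p : ℂ × ℂ => (g p, exp (2 * Real.pi * I * p.2))) (by fun_prop)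
      fun p hp => norm_nome_lt_one hp
  refine DifferentiableOn.congr ?_ fun p hp => jacobiTheta_eq p.1 hp
  exact ((DifferentiableOn.fun_mul (by fun_prop) (hE _ (by fun_prop))).fun_mul
    (hE _ (by fun_prop))).fun_mul (hE _ (by fun_prop))

theorem exp_mul_exp_eq_one_iff {a b : ℂ} :
    exp (2 * Real.pi * I * a) * exp (2 * Real.pi * I * b) = 1 ↔ ∃ k : ℤ, a + b = k := by
  rw [← exp_add, exp_eq_one_iff]
  refine exists_congr fun k => ?_
  rw [← mul_add, mul_comm]
  exact mul_left_inj' two_pi_I_ne_zero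

theorem nome_pow_mul_eq_one_iff {ν τ : ℂ} {n : ℕ} :
    exp (2 * Real.pi * I * τ) ^ n * exp (2 * Real.pi * I * ν) = 1 ↔ ∃ k : ℤ, n * τ + ν = k := by
  rw [← exp_nat_mul, ← exp_mul_exp_eq_one_iff]
  congr! 3
  ring

theorem qProd_nome_ne_zero {τ : ℂ} (hτ : 0 < τ.im) :
    qProd (exp (2 * Real.pi * I * τ)) (exp (2 * Real.pi * I * τ)) ≠ 0 := by
  rw [ne_eq, qProd_eq_zero_iff _ (norm_nome_lt_one hτ)]
  rintro ⟨n, hn⟩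
  have := pow_lt_one₀ (norm_nonneg _) (norm_nome_lt_one hτ) (Nat.succ_ne_zero n)
  rw [← norm_pow, pow_succ, hn, norm_one] at this
  exact lt_irrefl _ this

theorem qProd_exp_eq_zero_iff (ν : ℂ) {τ : ℂ} (hτ : 0 < τ.im) :
    qProd (exp (2 * Real.pi * I * ν)) (exp (2 * Real.pi * I * τ)) = 0 ↔
      ∃ (n : ℕ) (k : ℤ), n * τ + ν = k := by
  simp_rw [qProd_eq_zero_iff _ (norm_nome_lt_one hτ), nome_pow_mul_eq_one_iff]

theorem qProd_exp_neg_eq_zero_iff (ν : ℂ) {τ : ℂ} (hτ : 0 < τ.im) :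
    qProd (exp (2 * Real.pi * I * τ) * exp (-(2 * Real.pi * I * ν))) (exp (2 * Real.pi * I * τ)) = 0
      ↔ ∃ (n : ℕ) (k : ℤ), (n + 1 : ℕ) * τ - ν = k := by
  simp_rw [qProd_eq_zero_iff _ (norm_nome_lt_one hτ), ← mul_assoc, ← pow_succ, ← mul_neg,
    nome_pow_mul_eq_one_iff, ← sub_eq_add_neg]

theorem jacobiTheta_eq_zero_iff (ν : ℂ) {τ : ℂ} (hτ : 0 < τ.im) :
    jacobiTheta ν τ = 0 ↔ ∃ m k : ℤ, ν = m * τ + k := by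
  simp only [jacobiTheta_eq ν hτ, mul_eq_zero, I_ne_zero, exp_ne_zero, qProd_nome_ne_zero hτ,
    qProd_exp_eq_zero_iff ν hτ, qProd_exp_neg_eq_zero_iff ν hτ, false_or]
  constructor
  · rintro (⟨n, k, h⟩ | ⟨n, k, h⟩)
    · exact ⟨-n, k, by push_cast; linear_combination h⟩
    · exact ⟨n + 1, -k, by push_cast at h ⊢; linear_combination -h⟩
  · rintro ⟨m, k, rfl⟩
    rcases le_or_gt m 0 with hm | hm
    · obtain ⟨n, rfl⟩ := Int.exists_eq_neg_ofNat hm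
      exact Or.inl ⟨n, k, by push_cast; ring⟩
    · obtain ⟨n, rfl⟩ := Int.eq_succ_of_zero_lt hm
      exact Or.inr ⟨n, -k, by push_cast; ring⟩

theorem deriv_mul_ne_zero {f g : ℂ → ℂ} {x : ℂ} (hf : DifferentiableAt ℂ f x)
    (hg : DifferentiableAt ℂ g x) (h0 : f x = 0) (h1 : deriv f x ≠ 0) (h2 : g x ≠ 0) :
    deriv (fun y => f y * g y) x ≠ 0 := by
  rw [deriv_fun_mul hf hg, h0, zero_mul, add_zero]
  exact mul_ne_zero h1 h2

/-- The zeros of the theta function in `ν` are simple. -/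
theorem deriv_jacobiTheta_ne_zero {ν τ : ℂ} (hτ : 0 < τ.im) (h : jacobiTheta ν τ = 0) :
    deriv (fun ν => jacobiTheta ν τ) ν ≠ 0 := by
  have hq := norm_nome_lt_one hτ
  have hE := differentiable_qProd_left hq
  have hcomp : ∀ (g : ℂ → ℂ), Differentiable ℂ g →
      Differentiable ℂ (fun ν => qProd (g ν) (exp (2 * Real.pi * I * τ))) := fun g hg =>
    hE.comp hg
  have hder : ∀ (g : ℂ → ℂ) (g' : ℂ), HasDerivAt g g' ν → g' ≠ 0 →
      qProd (g ν) (exp (2 * Real.pi * I * τ)) = 0 →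
      deriv (fun ν => qProd (g ν) (exp (2 * Real.pi * I * τ))) ν ≠ 0 := fun g g' hg hg' h0 => by
    have := HasDerivAt.comp ν (hE (g ν)).hasDerivAt hg
    have h2 : deriv (fun ν => qProd (g ν) (exp (2 * Real.pi * I * τ))) ν = _ := this.deriv
    rw [h2]
    exact mul_ne_zero (deriv_qProd_ne_zero hq h0) hg'
  have hne : ∀ c : ℂ, I * exp (2 * Real.pi * I * τ / 8) * exp (-(I * Real.pi * c)) *
      qProd (exp (2 * Real.pi * I * τ)) (exp (2 * Real.pi * I * τ)) ≠ 0 := fun c =>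
    mul_ne_zero (mul_ne_zero (mul_ne_zero I_ne_zero (exp_ne_zero _)) (exp_ne_zero _))
      (qProd_nome_ne_zero hτ)
  have h2 := h
  rw [jacobiTheta_eq ν hτ, mul_eq_zero, mul_eq_zero, or_iff_right (hne ν)] at h2
  have hd1 := hcomp (fun ν => exp (2 * Real.pi * I * ν)) (by fun_prop)
  have hd2 := hcomp (fun ν => exp (2 * Real.pi * I * τ) * exp (-(2 * Real.pi * I * ν)))
    (by fun_prop)
  -- the zeros of the two products come from disjoint halves of the lattice
  have hdisj : ¬ (qProd (exp (2 * Real.pi * I * ν)) (exp (2 * Real.pi * I * τ)) = 0 ∧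
      qProd (exp (2 * Real.pi * I * τ) * exp (-(2 * Real.pi * I * ν)))
        (exp (2 * Real.pi * I * τ)) = 0) := by
    rw [qProd_exp_eq_zero_iff ν hτ, qProd_exp_neg_eq_zero_iff ν hτ]
    rintro ⟨⟨n, k, h1⟩, n', k', h2⟩
    have h3 : ((n + n' + 1 : ℕ) : ℂ) * τ = ((k + k' : ℤ) : ℂ) := by
      push_cast at h2 ⊢; linear_combination h1 + h2
    have h4 := congrArg im h3
    rw [← ofReal_natCast, im_ofReal_mul, intCast_im] at h4
    exact (mul_pos (Nat.cast_pos.2 (Nat.succ_pos _)) hτ).ne' h4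
  rcases h2 with h2 | h2
  · have h3 : (fun ν => jacobiTheta ν τ) = fun ν =>
        qProd (exp (2 * Real.pi * I * ν)) (exp (2 * Real.pi * I * τ)) *
        ((I * exp (2 * Real.pi * I * τ / 8) * exp (-(I * Real.pi * ν)) *
      qProd (exp (2 * Real.pi * I * τ)) (exp (2 * Real.pi * I * τ))) *
          qProd (exp (2 * Real.pi * I * τ) * exp (-(2 * Real.pi * I * ν)))
        (exp (2 * Real.pi * I * τ))) := by
      funext ν; rw [jacobiTheta_eq ν hτ]; ring
    rw [h3]
    refine deriv_mul_ne_zero (hd1 ν) (DifferentiableAt.fun_mul (by fun_prop) (hd2 ν)) h2 ?_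
      (mul_ne_zero (hne ν) fun h4 => hdisj ⟨h2, h4⟩)
    refine hder _ (exp (2 * Real.pi * I * ν) * (2 * Real.pi * I)) ?_
      (mul_ne_zero (exp_ne_zero _) two_pi_I_ne_zero) h2
    simpa using ((hasDerivAt_id ν).const_mul (2 * Real.pi * I)).cexp
  · have h3 : (fun ν => jacobiTheta ν τ) = fun ν =>
        qProd (exp (2 * Real.pi * I * τ) * exp (-(2 * Real.pi * I * ν)))
          (exp (2 * Real.pi * I * τ)) *
        ((I * exp (2 * Real.pi * I * τ / 8) * exp (-(I * Real.pi * ν)) *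
      qProd (exp (2 * Real.pi * I * τ)) (exp (2 * Real.pi * I * τ))) *
          qProd (exp (2 * Real.pi * I * ν)) (exp (2 * Real.pi * I * τ))) := by
      funext ν; rw [jacobiTheta_eq ν hτ]; ring
    rw [h3]
    refine deriv_mul_ne_zero (hd2 ν) (DifferentiableAt.fun_mul (by fun_prop) (hd1 ν)) h2 ?_
      (mul_ne_zero (hne ν) fun h4 => hdisj ⟨h4, h2⟩)
    refine hder _ (exp (2 * Real.pi * I * τ) *
      (exp (-(2 * Real.pi * I * ν)) * (-(2 * Real.pi * I)))) ?_
      (mul_ne_zero (exp_ne_zero _) (mul_ne_zero (exp_ne_zero _)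
        (neg_ne_zero.2 two_pi_I_ne_zero))) h2
    simpa using (((hasDerivAt_id ν).const_mul (2 * Real.pi * I)).fun_neg.cexp).const_mul
      (exp (2 * Real.pi * I * τ))

/-! ### Counting zeros through non-degeneracy -/

theorem eval_aeval {σ ι : Type*} (x : σ → ℂ) (g : ι → MvPolynomial σ ℂ) (p : MvPolynomial ι ℂ) :
    MvPolynomial.eval x (MvPolynomial.aeval g p)
      = MvPolynomial.eval (fun i => MvPolynomial.eval x (g i)) p := by
  induction p using MvPolynomial.induction_on with
  | C a => simp
  | add p q hp hq => simp only [map_add, hp, hq]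
  | mul_X p i hp => simp only [map_mul, hp, MvPolynomial.aeval_X, MvPolynomial.eval_X]

/-- Polynomials whose only common zero is the origin are at least as many as the variables: by the
Nullstellensatz they generate an ideal whose radical is a maximal ideal, and Krull's height theorem
applies. -/
theorem card_le_card_of_common_zero {σ ι : Type*} [Fintype σ] [Fintype ι]
    (f : ι → MvPolynomial σ ℂ) (h0 : ∀ t, MvPolynomial.eval 0 (f t) = 0)
    (h : ∀ x ≠ 0, ∃ t, MvPolynomial.eval x (f t) ≠ 0) :
    Fintype.card σ ≤ Fintype.card ι := by
  have hdim : ringKrullDim (MvPolynomial σ ℂ) = (Fintype.card σ : ℕ) := by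
    rw [MvPolynomial.ringKrullDim_of_isNoetherianRing, ringKrullDim_eq_zero_of_field, zero_add,
      Nat.card_eq_fintype_card]
  have : FiniteRingKrullDim (MvPolynomial σ ℂ) := by
    rw [finiteRingKrullDim_iff_ne_bot_and_top, hdim]
    exact ⟨WithBot.natCast_ne_bot _, fun h => by
      have : ((Fintype.card σ : ℕ∞) : WithBot ℕ∞) = ((⊤ : ℕ∞) : WithBot ℕ∞) := h
      exact ENat.natCast_ne_top _ (WithBot.coe_injective this)⟩
  obtain ⟨M, hM, hheight⟩ := Ideal.exists_isMaximal_height (R := MvPolynomial σ ℂ)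
  obtain ⟨a, rfl⟩ := MvPolynomial.eq_vanishingIdeal_singleton_of_isMaximal ℂ hM
  -- `M = (Xᵢ - aᵢ)` is only known to exist, so the system is translated to have its zero at `a`
  let g : ι → MvPolynomial σ ℂ := fun t =>
    MvPolynomial.aeval (fun i => MvPolynomial.X i - MvPolynomial.C (a i)) (f t)
  have hg : ∀ x t, MvPolynomial.aeval x (g t) = MvPolynomial.eval (x - a) (f t) := fun x t => by
    rw [MvPolynomial.aeval_eq_eval, eval_aeval]
    simp only [map_sub, MvPolynomial.eval_X, MvPolynomial.eval_C]
    rfl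
  have hloc : MvPolynomial.zeroLocus ℂ (Ideal.span (range g)) = {a} := by
    ext x
    rw [MvPolynomial.zeroLocus_span]
    simp only [mem_ofPred_eq, forall_mem_range, hg, mem_singleton_iff]
    constructor
    · intro hx
      by_contra hne
      obtain ⟨t, ht⟩ := h (x - a) (sub_ne_zero.2 hne)
      exact ht (hx t)
    · rintro rfl t
      rw [sub_self, h0]
  have hrad : MvPolynomial.vanishingIdeal ℂ {a} = (Ideal.span (range g)).radical := by
    rw [← hloc, MvPolynomial.vanishingIdeal_zeroLocus_eq_radical]
  have hmin : MvPolynomial.vanishingIdeal ℂ {a} ∈ (Ideal.span (range g)).minimalPrimes := by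
    refine ⟨⟨hM.isPrime, hrad ▸ Ideal.le_radical⟩, fun J hJ _ => ?_⟩
    rw [hrad]
    exact hJ.1.radical_le_iff.2 hJ.2
  have hle := Ideal.height_le_card_of_mem_minimalPrimes_span (finite_range g) hmin
  rw [hdim] at hheight
  have hh : (MvPolynomial.vanishingIdeal ℂ {a} : Ideal (MvPolynomial σ ℂ)).height
      = (Fintype.card σ : ℕ∞) := WithBot.coe_injective hheight
  rw [hh, Nat.cast_le] at hle
  refine hle.trans ?_
  rw [← Nat.card_eq_fintype_card (α := ι), ← image_univ, ← ncard_univ]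
  exact ncard_image_le finite_univ

theorem eval_pderiv_potential {d : ℕ} (A : Matrix (Fin d) (Fin d) ℕ) (x : Fin d → ℂ) (j : Fin d) :
    MvPolynomial.eval x (MvPolynomial.pderiv j (potential A)) =
      ∑ i, (A i j : ℂ) * ∏ k, x k ^ (A i k - if k = j then 1 else 0) := by
  rw [potential, map_sum, map_sum]
  refine Finset.sum_congr rfl fun i _ => ?_
  have h : ∏ k, (MvPolynomial.X k : MvPolynomial (Fin d) ℂ) ^ A i k
      = MvPolynomial.monomial (Finsupp.equivFunOnFinite.symm (A i)) 1 := by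
    rw [MvPolynomial.monomial_eq, Finsupp.prod_fintype _ _ (by simp)]
    simp
  rw [h, MvPolynomial.pderiv_monomial, MvPolynomial.eval_monomial,
    Finsupp.prod_fintype _ _ (by simp)]
  simp [Finsupp.single_apply, eq_comm]

/-- The inequality between zeros and poles. In the application the `u j` and `z` are points of an
elliptic curve. If `z ≠ 0`, no monomial of `W` involves only variables of
`S = {j | u j = 0}`, so `W` vanishes on the coordinate subspace `ℂ^S`. A partial derivative `∂_j W`
can be nonzero there only if `W` contains `x_j` times a monomial in the variables of `S`, which
forces `u j = z`. By non-degeneracy these partial derivatives have no common zero on `ℂ^S` but the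
origin, so there are at least `|S|` of them. The hypothesis on the degrees makes the origin a common
zero. -/
theorem card_eq_zero_le_card_eq {d : ℕ} {A : Matrix (Fin d) (Fin d) ℕ}
    (hW : IsNondegenerate (potential A)) (h2 : ∀ i, 2 ≤ ∑ j, A i j)
    {M : Type*} [AddCommGroup M] [DecidableEq M] (z : M) (u : Fin d → M)
    (hu : ∀ i, ∑ j, A i j • u j = z) :
    (Finset.univ.filter fun j => u j = 0).card ≤ (Finset.univ.filter fun j => u j = z).card := by
  by_cases hz : z = 0
  · rw [hz]
  rw [← Fintype.card_subtype, ← Fintype.card_subtype]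
  -- extension of a point of the coordinate subspace by zero
  let ext : ({j // u j = 0} → ℂ) → Fin d → ℂ := fun x k => if h : u k = 0 then x ⟨k, h⟩ else 0
  let f : {j // u j = z} → MvPolynomial {j // u j = 0} ℂ := fun j =>
    MvPolynomial.aeval (fun k => if h : u k = 0 then MvPolynomial.X ⟨k, h⟩ else 0)
      (MvPolynomial.pderiv j.1 (potential A))
  have hf : ∀ x j, MvPolynomial.eval x (f j)
      = MvPolynomial.eval (ext x) (MvPolynomial.pderiv j.1 (potential A)) := fun x j => by
    rw [eval_aeval]
    refine congrArg (fun y => MvPolynomial.eval y _) (funext fun k => ?_)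
    simp only [ext]
    split_ifs <;> simp
  -- a nonzero partial derivative at `x` has a term whose variables do not vanish at `x`
  have hterm : ∀ (x : Fin d → ℂ) (j : Fin d),
      MvPolynomial.eval x (MvPolynomial.pderiv j (potential A)) ≠ 0 →
      ∃ i, A i j ≠ 0 ∧ ∀ k, x k = 0 → A i k ≤ if k = j then 1 else 0 := fun x j hj => by
    rw [eval_pderiv_potential] at hj
    obtain ⟨i, -, hi⟩ := Finset.exists_ne_zero_of_sum_ne_zero hj
    refine ⟨i, fun h => hi (by simp [h]), fun k hk => ?_⟩
    have := Finset.prod_ne_zero_iff.1 (right_ne_zero_of_mul hi) k (Finset.mem_univ k)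
    rw [hk] at this
    exact Nat.sub_eq_zero_iff_le.1 (by_contra fun hne => this (zero_pow hne))
  refine card_le_card_of_common_zero f (fun j => ?_) fun x hx => ?_
  · rw [hf]
    by_contra hne
    obtain ⟨i, -, hi⟩ := hterm _ _ hne
    have h1 : ∑ k, A i k ≤ ∑ k, if k = j.1 then 1 else 0 :=
      Finset.sum_le_sum fun k _ => hi k (by simp [ext])
    rw [Finset.sum_ite_eq' Finset.univ j.1 fun _ => 1, if_pos (Finset.mem_univ _)] at h1
    exact absurd ((h2 i).trans h1) (by norm_num)
  · -- every monomial involves a variable outside the subspace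
    have hx0 : ext x ≠ 0 := fun h => hx <| by
      funext k
      have := congrFun h k.1
      simpa [ext, k.2] using this
    have hWx : MvPolynomial.eval (ext x) (potential A) = 0 := by
      rw [potential, map_sum]
      refine Finset.sum_eq_zero fun i _ => ?_
      obtain ⟨k, -, hk⟩ := Finset.exists_ne_zero_of_sum_ne_zero ((hu i).trans_ne hz)
      rw [map_prod]
      refine Finset.prod_eq_zero (Finset.mem_univ k) ?_
      rw [map_pow, MvPolynomial.eval_X]
      simp only [ext]
      rw [dif_neg fun h => hk (by rw [h, smul_zero]), zero_pow fun h => hk (by rw [h, zero_smul])]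
    obtain ⟨j, hj⟩ := hW _ hx0 hWx
    obtain ⟨i, hij, hi⟩ := hterm _ _ hj
    have hsum : A i j • u j = z := by
      rw [← hu i, Finset.sum_eq_single j]
      · intro k _ hkj
        by_cases hk : u k = 0
        · rw [hk, smul_zero]
        · have := hi k (by simp [ext, hk])
          rw [if_neg hkj, Nat.le_zero] at this
          rw [this, zero_smul]
      · simp
    have huj : u j ≠ 0 := fun h => hz (by rw [← hsum, h, smul_zero])
    have h1 := hi j (by simp [ext, huj])
    rw [if_pos rfl] at h1
    have hA1 : A i j = 1 := le_antisymm h1 (Nat.one_le_iff_ne_zero.2 hij)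
    rw [hA1, one_smul] at hsum
    exact ⟨⟨j, hsum⟩, by rwa [hf]⟩

/-! ### The summands of the orbifold sum -/

theorem analyticOrderAt_finsetProd {ι : Type*} (s : Finset ι) {f : ι → ℂ → ℂ} {z : ℂ}
    (hf : ∀ i, AnalyticAt ℂ (f i) z) :
    analyticOrderAt (fun w => ∏ i ∈ s, f i w) z = ∑ i ∈ s, analyticOrderAt (f i) z := by
  classical
  induction s using Finset.induction_on with
  | empty =>
    simp only [Finset.prod_empty, Finset.sum_empty]
    exact analyticAt_const.analyticOrderAt_eq_zero.2 one_ne_zero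
  | insert a s ha ih =>
    simp only [Finset.prod_insert ha, Finset.sum_insert ha]
    rw [← ih]
    exact analyticOrderAt_mul (hf a) (Finset.analyticAt_fun_prod s fun i _ => hf i)

theorem differentiable_jacobiTheta_left {τ : ℂ} (hτ : 0 < τ.im) :
    Differentiable ℂ fun ν => jacobiTheta ν τ := by
  rw [← differentiableOn_univ]
  exact differentiableOn_jacobiTheta.comp (f := fun ν : ℂ => (ν, τ)) (by fun_prop) fun _ _ => hτ

theorem analyticOrderAt_jacobiTheta_comp {τ : ℂ} (hτ : 0 < τ.im) {a c : ℂ} (ha : a ≠ 0) {z : ℂ}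
    (h : jacobiTheta (a * z + c) τ = 0) :
    analyticOrderAt (fun z => jacobiTheta (a * z + c) τ) z = 1 := by
  have hd := differentiable_jacobiTheta_left hτ
  have hcomp : Differentiable ℂ (fun z => jacobiTheta (a * z + c) τ) :=
    hd.comp (g := fun ν => jacobiTheta ν τ) (f := fun z => a * z + c) (by fun_prop)
  refine (hcomp.analyticAt z).analyticOrderAt_eq_one_of_zero_deriv_ne_zero h ?_
  have h1 : HasDerivAt (fun z => a * z + c) a z := by
    simpa using ((hasDerivAt_id z).const_mul a).add_const c
  have h2 := HasDerivAt.comp z (h₂ := fun ν => jacobiTheta ν τ) (hd (a * z + c)).hasDerivAt h1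
  have h3 : deriv (fun z => jacobiTheta (a * z + c) τ) z = _ := h2.deriv
  rw [h3]
  exact mul_ne_zero (deriv_jacobiTheta_ne_zero hτ h) ha

/-- The zeros of `Θ(·, τ)` are the points of the lattice `ℤτ + ℤ`. -/
theorem jacobiTheta_eq_zero_iff_mk {ν τ : ℂ} (hτ : 0 < τ.im) :
    jacobiTheta ν τ = 0 ↔ (ν : ℂ ⧸ AddSubgroup.closure ({τ, 1} : Set ℂ)) = 0 := by
  rw [jacobiTheta_eq_zero_iff ν hτ, QuotientAddGroup.eq_zero_iff, AddSubgroup.mem_closure_pair]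
  simp [eq_comm]

theorem jacobiDomain_eq : jacobiDomain = univ ×ˢ {τ : ℂ | 0 < τ.im} := by
  ext p; simp [jacobiDomain]

/-- Every summand of the orbifold sum extends holomorphically. For fixed `τ`, the order at `z` of
the product of the denominators is the number of `j` with `D_j = q_j z + a_j τ + b_j` in the lattice
`ℤτ + ℤ`, that of the product of the numerators is at least the number of `j` with `z - D_j` in the
lattice, and `card_eq_zero_le_card_eq` compares the two. -/
theorem exists_extension_prod_jacobiTheta {d : ℕ} {A : Matrix (Fin d) (Fin d) ℕ}
    (hW : IsNondegenerate (potential A)) (h2 : ∀ i, 2 ≤ ∑ j, A i j) {q : Fin d → ℚ}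
    (hq_pos : ∀ j, 0 < q j) (hq : ∀ i, ∑ j, (A i j : ℚ) * q j = 1) (a b : Fin d → ℝ)
    (ha : ∀ i, ∃ k : ℤ, ∑ j, (A i j : ℝ) * a j = k)
    (hb : ∀ i, ∃ k : ℤ, ∑ j, (A i j : ℝ) * b j = k) :
    ∃ F : ℂ × ℂ → ℂ, DifferentiableOn ℂ F jacobiDomain ∧ ∀ z τ : ℂ, 0 < τ.im →
      (∀ j, jacobiTheta ((q j : ℂ) * z + (a j : ℂ) * τ + (b j : ℂ)) τ ≠ 0) →
      F (z, τ) = ∏ j, jacobiTheta ((1 - (q j : ℂ)) * z - (a j : ℂ) * τ - (b j : ℂ)) τ /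
        jacobiTheta ((q j : ℂ) * z + (a j : ℂ) * τ + (b j : ℂ)) τ := by
  classical
  let D : Fin d → ℂ × ℂ → ℂ := fun j p => (q j : ℂ) * p.1 + (a j : ℂ) * p.2 + (b j : ℂ)
  let N : Fin d → ℂ × ℂ → ℂ := fun j p => (1 - (q j : ℂ)) * p.1 - (a j : ℂ) * p.2 - (b j : ℂ)
  have hΘ : ∀ g : ℂ × ℂ → ℂ, Differentiable ℂ g →
      DifferentiableOn ℂ (fun p : ℂ × ℂ => jacobiTheta (g p) p.2) jacobiDomain := fun g hg =>
    differentiableOn_jacobiTheta.comp (f := fun p : ℂ × ℂ => (g p, p.2)) (by fun_prop)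
      fun p hp => hp
  have hN : DifferentiableOn ℂ (fun p => ∏ j, jacobiTheta (N j p) p.2) jacobiDomain :=
    differentiableOn_finsetProd _ fun j => hΘ (N j) (by fun_prop)
  have hD : DifferentiableOn ℂ (fun p => ∏ j, jacobiTheta (D j p) p.2) jacobiDomain :=
    differentiableOn_finsetProd _ fun j => hΘ (D j) (by fun_prop)
  have hslice : ∀ τ : ℂ, 0 < τ.im → ∀ g : ℂ → ℂ, Differentiable ℂ g → ∀ z,
      AnalyticAt ℂ (fun z => jacobiTheta (g z) τ) z := fun τ hτ g hg z =>
    Differentiable.analyticAt (f := fun z => jacobiTheta (g z) τ)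
      ((differentiable_jacobiTheta_left hτ).comp hg) z
  have hordD : ∀ τ : ℂ, 0 < τ.im → ∀ z,
      analyticOrderAt (fun z => ∏ j, jacobiTheta (D j (z, τ)) τ) z =
        ((Finset.univ.filter fun j =>
          (D j (z, τ) : ℂ ⧸ AddSubgroup.closure ({τ, 1} : Set ℂ)) = 0).card : ℕ) := by
    intro τ hτ z
    have han : ∀ j, AnalyticAt ℂ (fun z => jacobiTheta (D j (z, τ)) τ) z := fun j =>
      hslice τ hτ (fun z => D j (z, τ)) (by fun_prop) z
    rw [analyticOrderAt_finsetProd _ han, Finset.natCast_card_filter]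
    refine Finset.sum_congr rfl fun j _ => ?_
    split_ifs with h
    · rw [← jacobiTheta_eq_zero_iff_mk hτ] at h
      simp only [D, add_assoc] at h ⊢
      exact analyticOrderAt_jacobiTheta_comp hτ (by exact_mod_cast (hq_pos j).ne') h
    · rw [← jacobiTheta_eq_zero_iff_mk hτ] at h
      exact (han j).analyticOrderAt_eq_zero.2 h
  have hordN : ∀ τ : ℂ, 0 < τ.im → ∀ z,
      ((Finset.univ.filter fun j =>
          (D j (z, τ) : ℂ ⧸ AddSubgroup.closure ({τ, 1} : Set ℂ)) = z).card : ℕ) ≤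
      analyticOrderAt (fun z => ∏ j, jacobiTheta (N j (z, τ)) τ) z := by
    intro τ hτ z
    have han : ∀ j, AnalyticAt ℂ (fun z => jacobiTheta (N j (z, τ)) τ) z := fun j =>
      hslice τ hτ (fun z => N j (z, τ)) (by fun_prop) z
    rw [analyticOrderAt_finsetProd _ han, Finset.natCast_card_filter]
    refine Finset.sum_le_sum fun j _ => ?_
    -- for a lower bound on the order, vanishing of the numerator is enough
    split_ifs with h
    · rw [Order.one_le_iff_ne_zero, (han j).analyticOrderAt_ne_zero,
        jacobiTheta_eq_zero_iff_mk hτ]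
      have hND : N j (z, τ) = z - D j (z, τ) := by simp only [N, D]; ring
      rw [hND, QuotientAddGroup.mk_sub, h, sub_self]
    · exact zero_le
  have hle : ∀ τ : ℂ, 0 < τ.im → ∀ z,
      (Finset.univ.filter fun j =>
          (D j (z, τ) : ℂ ⧸ AddSubgroup.closure ({τ, 1} : Set ℂ)) = 0).card ≤
      (Finset.univ.filter fun j =>
          (D j (z, τ) : ℂ ⧸ AddSubgroup.closure ({τ, 1} : Set ℂ)) = z).card := by
    intro τ hτ z
    refine card_eq_zero_le_card_eq hW h2 _ _ fun i => ?_
    obtain ⟨k, hk⟩ := ha i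
    obtain ⟨l, hl⟩ := hb i
    have hk' : ∑ j, (A i j : ℂ) * (a j : ℂ) = k := by exact_mod_cast congrArg ofReal hk
    have hl' : ∑ j, (A i j : ℂ) * (b j : ℂ) = l := by exact_mod_cast congrArg ofReal hl
    have hq' : ∑ j, (A i j : ℂ) * (q j : ℂ) = 1 := by
      exact_mod_cast congrArg (Rat.cast (K := ℂ)) (hq i)
    have hsum : ∑ j, A i j • D j (z, τ) = z + (k * τ + l) := by
      calc ∑ j, A i j • D j (z, τ)
          = (∑ j, (A i j : ℂ) * (q j : ℂ)) * z + (∑ j, (A i j : ℂ) * (a j : ℂ)) * τ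
            + ∑ j, (A i j : ℂ) * (b j : ℂ) := by
            rw [Finset.sum_mul, Finset.sum_mul, ← Finset.sum_add_distrib,
              ← Finset.sum_add_distrib]
            refine Finset.sum_congr rfl fun j _ => ?_
            simp only [D, nsmul_eq_mul]
            ring
        _ = _ := by rw [hq', hk', hl']; ring
    have hmk := congrArg (QuotientAddGroup.mk' (AddSubgroup.closure ({τ, 1} : Set ℂ))) hsum
    rw [map_sum, map_add] at hmk
    have h0 : QuotientAddGroup.mk' (AddSubgroup.closure ({τ, 1} : Set ℂ)) (k * τ + l) = 0 := by
      rw [QuotientAddGroup.mk'_apply, QuotientAddGroup.eq_zero_iff, AddSubgroup.mem_closure_pair]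
      exact ⟨k, l, by simp⟩
    rw [h0, add_zero] at hmk
    simpa only [map_nsmul, QuotientAddGroup.mk'_apply] using hmk
  rw [jacobiDomain_eq] at hN hD ⊢
  obtain ⟨F, hF, hFeq⟩ := exists_differentiableOn_eq_div isOpen_upperHalfPlane hN hD
    (fun τ hτ z => by
      rw [hordD τ hτ z]
      exact (Nat.cast_le.2 (hle τ hτ z)).trans (hordN τ hτ z))
    (fun τ hτ z => by rw [hordD τ hτ z]; exact ENat.natCast_ne_top _)
  refine ⟨F, hF, fun z τ hτ hne => ?_⟩
  rw [hFeq (z, τ) ⟨trivial, hτ⟩ (Finset.prod_ne_zero_iff.2 fun j _ => hne j),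
    Finset.prod_div_distrib]

theorem exp_angle {d : ℕ} {γ : Fin d → ℂˣ} {j : Fin d} (h : ‖(γ j : ℂ)‖ = 1) :
    exp (2 * Real.pi * I * (angle γ j : ℂ)) = γ j := by
  have hpi : (Real.pi : ℂ) ≠ 0 := by exact_mod_cast Real.pi_ne_zero
  rw [angle, Int.fract]
  push_cast
  have : 2 * Real.pi * I * ((arg (γ j : ℂ) : ℂ) / (2 * Real.pi)
      - (⌊arg (γ j : ℂ) / (2 * Real.pi)⌋ : ℤ)) = arg (γ j : ℂ) * I
      - (⌊arg (γ j : ℂ) / (2 * Real.pi)⌋ : ℤ) * (2 * Real.pi * I) := by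
    field_simp
  rw [this, exp_sub, exp_int_mul_two_pi_mul_I, div_one]
  simpa [h] using norm_mul_exp_arg_mul_I (γ j : ℂ)

theorem exists_sum_mul_angle_eq_intCast {d : ℕ} {A : Matrix (Fin d) (Fin d) ℕ} {γ : Fin d → ℂˣ}
    (hγ : γ ∈ autGroup A) (hfin : IsOfFinOrder γ) (i : Fin d) :
    ∃ k : ℤ, ∑ j, (A i j : ℝ) * angle γ j = k := by
  obtain ⟨N, hN, hpow⟩ := isOfFinOrder_iff_pow_eq_one.1 hfin
  have hnorm : ∀ j, ‖(γ j : ℂ)‖ = 1 := fun j => by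
    refine norm_eq_one_of_pow_eq_one (n := N) ?_ hN.ne'
    have := congrArg Units.val (congrFun hpow j)
    simpa using this
  have h1 : exp (2 * Real.pi * I * ((∑ j, (A i j : ℝ) * angle γ j : ℝ) : ℂ)) = 1 := by
    have h2 := congrArg Units.val (hγ i)
    rw [Units.coe_prod] at h2
    push_cast at h2 ⊢
    rw [Finset.mul_sum, exp_sum, ← h2]
    refine Finset.prod_congr rfl fun j _ => ?_
    rw [← exp_angle (hnorm j), ← exp_nat_mul]
    congr 1
    ring
  obtain ⟨k, hk⟩ := exp_eq_one_iff.1 h1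
  refine ⟨k, ?_⟩
  rw [mul_comm] at hk
  exact_mod_cast mul_right_cancel₀ two_pi_I_ne_zero hk

/-- For fixed `τ`, only countably many `z` are zeros of a denominator. -/
theorem jacobiDomain_subset_closure_regularSet {d : ℕ} {q : Fin d → ℚ} (hq_pos : ∀ j, 0 < q j)
    (G : Subgroup (Fin d → ℂˣ)) [Finite G] : jacobiDomain ⊆ closure (regularSet q G) := by
  rintro ⟨z₀, τ⟩ hτ
  let Z : Set ℂ := ⋃ (n : G) (n₁ : G) (j : Fin d) (m : ℤ) (k : ℤ),
    {((m : ℂ) * τ + k - (angle (n : Fin d → ℂˣ) j : ℂ) * τ - (angle (n₁ : Fin d → ℂˣ) j : ℂ)) /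
      (q j : ℂ)}
  have hZ : Z.Countable := countable_iUnion fun n => countable_iUnion fun n₁ =>
    countable_iUnion fun j => countable_iUnion fun m => countable_iUnion fun k =>
      countable_singleton _
  have hz₀ : z₀ ∈ closure Zᶜ := (hZ.dense_compl ℂ) z₀
  refine map_mem_closure (f := fun z : ℂ => (z, τ)) (by fun_prop) hz₀ fun z hz => ⟨hτ, ?_⟩
  intro n hn n₁ hn₁ j h0
  rw [denTheta, jacobiTheta_eq_zero_iff _ hτ] at h0
  obtain ⟨m, k, hmk⟩ := h0
  have hqj : (q j : ℂ) ≠ 0 := by exact_mod_cast (hq_pos j).ne'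
  refine hz ?_
  simp only [Z, mem_iUnion, mem_singleton_iff]
  refine ⟨⟨n, hn⟩, ⟨n₁, hn₁⟩, j, m, k, ?_⟩
  rw [eq_div_iff hqj]
  linear_combination hmk

/-- If a monomial of `W` is a single variable `x_j`, then `q_j = 1` and `γ_j = 1` for every diagonal
automorphism `γ`, so the `j`-th numerator of each summand is `Θ(0, τ) = 0`. -/
theorem ell_eq_zero {d : ℕ} {A : Matrix (Fin d) (Fin d) ℕ} {q : Fin d → ℚ}
    (hq : ∀ i, ∑ j, (A i j : ℚ) * q j = 1) {G : Subgroup (Fin d → ℂˣ)} (hG : G ≤ autGroup A)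
    {i : Fin d} (hi : ∑ j, A i j < 2) (z τ : ℂ) : ell q G z τ = 0 := by
  obtain ⟨j, -, hj⟩ := Finset.exists_ne_zero_of_sum_ne_zero ((hq i).trans_ne one_ne_zero)
  have hj0 : A i j ≠ 0 := fun h => hj (by simp [h])
  have hrow : ∀ k, A i k = if k = j then 1 else 0 := by
    rw [← Finset.add_sum_erase _ _ (Finset.mem_univ j)] at hi
    intro k
    split_ifs with hk
    · subst hk; omega
    · have := Finset.single_le_sum (f := A i) (fun _ _ => Nat.zero_le _)
        (Finset.mem_erase.2 ⟨hk, Finset.mem_univ k⟩)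
      omega
  have hqj : q j = 1 := by simpa [hrow] using hq i
  have hangle : ∀ γ ∈ G, angle γ j = 0 := fun γ hγ => by
    have : γ j = 1 := by simpa [hrow] using hG hγ i
    simp [angle, this]
  rw [ell]
  have : ∀ p : G × G, ∏ j, exp (-(I * 2 * Real.pi * z * (angle (p.1 : Fin d → ℂˣ) j : ℂ))) *
      (numTheta q p.1 p.2 j z τ / denTheta q p.1 p.2 j z τ) = 0 := fun p => by
    refine Finset.prod_eq_zero (Finset.mem_univ j) ?_
    have : numTheta q p.1 p.2 j z τ = 0 := by
      simp [numTheta, hqj, hangle _ p.1.2, hangle _ p.2.2, jacobiTheta]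
    rw [this, zero_div, mul_zero]
  simp [this]

end BerglundHubsch
end

theorem mainTheorem2 (d : ℕ) (A : Matrix (Fin d) (Fin d) ℕ)
    (hA : IsUnit (A.map (Nat.cast : ℕ → ℚ)))
    (q : Fin d → ℚ) (hq_pos : ∀ j, 0 < q j)
    (hq : ∀ i, ∑ j, (A i j : ℚ) * q j = 1)
    (hW : BerglundHubsch.IsNondegenerate (BerglundHubsch.potential A))
    (hCY : ∃ k : ℕ, 0 < k ∧ ∑ j, q j = (k : ℚ))
    (G : Subgroup (Fin d → ℂˣ))
    (hJG : Subgroup.zpowers (BerglundHubsch.gradingOp q) ≤ G)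
    (hGSL : G ≤ BerglundHubsch.slGroup A) :
    BerglundHubsch.jacobiDomain ⊆ closure (BerglundHubsch.regularSet q G) ∧
    ∃ F : ℂ × ℂ → ℂ,
      DifferentiableOn ℂ F BerglundHubsch.jacobiDomain ∧
      ∀ z τ : ℂ, (z, τ) ∈ BerglundHubsch.regularSet q G →
        F (z, τ) = BerglundHubsch.ell q G z τ := by
  have hG : G ≤ BerglundHubsch.autGroup A := fun γ hγ => (hGSL hγ).1
  have hfin : Finite G := BerglundHubsch.finite_of_le_autGroup A hA G hG
  refine ⟨BerglundHubsch.jacobiDomain_subset_closure_regularSet hq_pos G, ?_⟩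
  by_cases h2 : ∀ i, 2 ≤ ∑ j, A i j
  · have hint : ∀ n : G, ∀ i, ∃ k : ℤ,
        ∑ j, (A i j : ℝ) * BerglundHubsch.angle (n : Fin d → ℂˣ) j = k := fun n =>
      BerglundHubsch.exists_sum_mul_angle_eq_intCast (hG n.2)
        (Submonoid.isOfFinOrder_coe.2 (isOfFinOrder_of_finite n))
    choose F hF hFeq using fun p : G × G =>
      BerglundHubsch.exists_extension_prod_jacobiTheta hW h2 hq_pos hq _ _ (hint p.1) (hint p.2)
    have := Fintype.ofFinite G
    refine ⟨fun x => 1 / (Nat.card G : ℂ) * ∑ p : G × G, (∏ j, exp (-(I * 2 * Real.pi * x.1 *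
      (BerglundHubsch.angle (p.1 : Fin d → ℂˣ) j : ℂ)))) * F p x, ?_, fun z τ hz => ?_⟩
    · refine (differentiableOn_const _).fun_mul (DifferentiableOn.fun_sum fun p _ => ?_)
      exact (BerglundHubsch.differentiableOn_finsetProd _ fun j => by fun_prop).fun_mul (hF p)
    · rw [BerglundHubsch.ell, finsum_eq_sum_of_fintype]
      refine congrArg _ (Finset.sum_congr rfl fun p _ => ?_)
      rw [Finset.prod_mul_distrib, hFeq p z τ hz.1 fun j => hz.2 _ p.1.2 _ p.2.2 j]
      rfl
  · -- a monomial of degree one makes the orbifold sum vanish identically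
    push Not at h2
    obtain ⟨i, hi⟩ := h2
    exact ⟨0, differentiableOn_const 0, fun z τ _ =>
      (BerglundHubsch.ell_eq_zero hq hG hi z τ).symm⟩
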